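/- Let the cake be $[0,1]$. A density is a function $f:[0,1]\to\mathbb R_{\ge 0}$ that is piecewise constant (constant on each part of some partition of $[0,1]$ into finitely many intervals) and satisfies $\int_0^1 f>0$; its value for $S\subseteq[0,1]$ is $v_f(S)=\int_S f(x)\,dx$. For $n\ge 1$ agents, an allocation is a tuple $(A_1,\dots,A_n)$ of finite unions of closed subintervals of $[0,1]$ of positive length such that $A_i\cap A_j$ has measure zero for $i\ne j$; it is complete if $\bigcup_i A_i=[0,1]$. Its Nash welfare for a profile $(f_1,\dots,f_n)$ of densities is $\bigl(\prod_i v_{f_i}(A_i)\bigr)^{1/n}$. A (deterministic) mechanism $M$ maps every profile $\mathbf f=(f_1,\dots,f_n)$ of reported densities, for every $n\ge1$, to an allocation $(M_1(\mathbf f),\dots,M_n(\mathbf f))$. It is an MNW mechanism without free disposal if $M(\mathbf f)$ always is a complete allocation that maximizes the Nash welfare among all complete allocations, and an MNW mechanism with free disposal if $M(\mathbf f)$ always maximizes the Nash welfare among all allocations; in both cases ties may be broken arbitrarily (in the second case, pieces that no agent values may be discarded). The incentive ratio of $M$ for $n$ agents is $$\mathrm{IR}_n(M)=\sup_{f_1,\dots,f_n}\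 \sup_{1\le i\le n}\ \sup_{f_i'}\ \frac{v_{f_i}\bigl(M_i(f_1,\dots,f_i',\dots,f_n)\bigr)}{v_{f_i}\bigl(M_i(f_1,\dots,f_i,\dots,f_n)\bigr)},$$ and the incentive ratio of $M$ is $\mathrm{IR}(M)=\sup_{n\ge1}\mathrm{IR}_n(M)$. **Theorem.** MNW mechanisms without free disposal and with free disposal exist. Every MNW mechanism $M$ without free disposal has $\mathrm{IR}(M)=2$, and $\mathrm{IR}_n(M)\ge 2-\frac1n$ for every $n\ge1$. The lower bounds hold even with free disposal: every MNW mechanism $M$ with free disposal has $\mathrm{IR}(M)\ge2$ and $\mathrm{IR}_n(M)\ge 2-\frac1n$ for every $n\ge1$. More precisely, for every $n\ge 1$ let $f_1$ take the values $n,\ n-1,\ 0$ and let $f_i$, for $2\le i\le n$, take the values $0,\ 1,\ n-1$ on $[0,\frac13]$, $(\frac13,\frac23]$, $(\frac23,1]$ respectively. Then for every $\varepsilon>0$ there is a density $f_1'$, constant on each of these three intervals, such that for all allocations $A$ and $A'$ that maximize the Nash welfare among all allocations for the profiles $(f_1,f_2,\dots,f_n)$ and $(f_1',f_2,\dots,f_n)$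 respectively, $$\frac{v_{f_1}(A'_1)}{v_{f_1}(A_1)}\ \ge\ 2-\frac1n-\varepsilon .$$ -/

import Mathlib

open Set MeasureTheory
open scoped ENNReal

namespace CakeCutting

/-- The cake `[0, 1]`. -/
def cake : Set ℝ := Icc 0 1

/-- `f` is piecewise constant on the cake: the cake can be partitioned into finitely many
intervals (order-connected sets) on each of which `f` is constant. -/
def PiecewiseConstant (f : ℝ → ℝ) : Prop :=
  ∃ (m : ℕ) (X : Fin m → Set ℝ),
    (∀ t, (X t).OrdConnected) ∧
    (∀ s t, s ≠ t → Disjoint (X s) (X t)) ∧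
    (⋃ t, X t) = cake ∧
    ∀ t, ∃ c : ℝ, ∀ x ∈ X t, f x = c

/-- A piecewise constant density function `[0, 1] → ℝ≥0` giving a strictly positive value to the
entire cake. A function on `[0, 1]` is represented by its extension by zero to `ℝ`. -/
structure Density where
  toFun : ℝ → ℝ
  nonneg : ∀ x, 0 ≤ toFun x
  zero_off : ∀ x, x ∉ cake → toFun x = 0
  piecewiseConstant : PiecewiseConstant toFun
  pos : 0 < ∫ x in cake, toFun x

/-- The value `v(S) = ∫_S f(x) dx`. -/
noncomputable def value (f : Density) (S : Set ℝ) : ℝ := ∫ x in S, f.toFun x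

/-- A bundle: a finite (possibly empty) union of closed intervals of positive length contained in
the cake. -/
def IsBundle (S : Set ℝ) : Prop :=
  ∃ (k : ℕ) (a b : Fin k → ℝ),
    (∀ j, 0 ≤ a j ∧ a j < b j ∧ b j ≤ 1) ∧ S = ⋃ j, Icc (a j) (b j)

/-- An allocation when free disposal is allowed: bundles that overlap pairwise in null sets; part
of the cake may remain unallocated. -/
def IsAllocation {n : ℕ} (A : Fin n → Set ℝ) : Prop :=
  (∀ i, IsBundle (A i)) ∧ ∀ i j, i ≠ j → volume (A i ∩ A j) = 0

/-- An allocation without free disposal: in addition, the whole cake is allocated. -/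
def IsCompleteAllocation {n : ℕ} (A : Fin n → Set ℝ) : Prop :=
  IsAllocation A ∧ (⋃ i, A i) = cake

/-- The Nash welfare, i.e. the geometric mean of the agents' values. -/
noncomputable def nashWelfare {n : ℕ} (f : Fin n → Density) (A : Fin n → Set ℝ) : ℝ :=
  (∏ i, value (f i) (A i)) ^ (1 / (n : ℝ))

/-- `A` maximizes the Nash welfare over all complete allocations. -/
def IsMNW {n : ℕ} (f : Fin n → Density) (A : Fin n → Set ℝ) : Prop :=
  IsCompleteAllocation A ∧
    ∀ B : Fin n → Set ℝ, IsCompleteAllocation B → nashWelfare f B ≤ nashWelfare f A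

/-- `A` maximizes the Nash welfare over all allocations, with free disposal. (Whether the pieces
that no agent values are allocated or discarded is left open, so both conventions are covered.) -/
def IsFreeDisposalMNW {n : ℕ} (f : Fin n → Density) (A : Fin n → Set ℝ) : Prop :=
  IsAllocation A ∧
    ∀ B : Fin n → Set ℝ, IsAllocation B → nashWelfare f B ≤ nashWelfare f A

/-- A deterministic mechanism maps each profile of reported densities, for each number of agents,
to a tuple of bundles. -/
def Mechanism : Type := (n : ℕ) → (Fin n → Density) → Fin n → Set ℝ

/-- `M` is an MNW mechanism without free disposal, for some tie-breaking rule. -/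
def IsMNWMechanism (M : Mechanism) : Prop :=
  ∀ n : ℕ, 1 ≤ n → ∀ f : Fin n → Density, IsMNW f (M n f)

/-- `M` is an MNW mechanism with free disposal, for some tie-breaking rule. -/
def IsFreeDisposalMNWMechanism (M : Mechanism) : Prop :=
  ∀ n : ℕ, 1 ≤ n → ∀ f : Fin n → Density, IsFreeDisposalMNW f (M n f)

/-- The incentive ratio of `M` restricted to instances with `n` agents: the supremum over true
profiles `f`, agents `i` and misreports `g` of agent `i` of the ratio between the true value that
`i` obtains by reporting `g` and the one obtained by reporting `f i`. -/
noncomputable def incentiveRatioFor (M : Mechanism) (n : ℕ) : ℝ≥0∞ :=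
  ⨆ (f : Fin n → Density) (i : Fin n) (g : Density),
    ENNReal.ofReal (value (f i) (M n (Function.update f i g) i)) /
      ENNReal.ofReal (value (f i) (M n f i))

/-- The incentive ratio of `M`. -/
noncomputable def incentiveRatio (M : Mechanism) : ℝ≥0∞ :=
  ⨆ n : ℕ, incentiveRatioFor M n

/-- `f` takes the constant values `a`, `b`, `c` on the three thirds of the cake. -/
def IsThreeStep (f : Density) (a b c : ℝ) : Prop :=
  (∀ x ∈ Icc (0 : ℝ) (1 / 3), f.toFun x = a) ∧
  (∀ x ∈ Ioc (1 / 3 : ℝ) (2 / 3), f.toFun x = b) ∧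
  (∀ x ∈ Ioc (2 / 3 : ℝ) 1, f.toFun x = c)

end CakeCutting

open CakeCutting

/-!
Densities and bundles consist of finitely many intervals, so the problem reduces to a linear Fisher
market. Any finite family of densities is constant on the cells of a common grid (`exists_grid`);
an allocation gives each agent a share of each cell, her value depends only on these shares, and
every division of the cells without leftovers arises by cutting each cell into consecutive
intervals (`exists_share_eq`). Maximizing Nash welfare thus means maximizing a product of linear
utilities over the divisions of finitely many goods. A maximizer exists by compactness. Leftovers
can be handed to anybody, so a maximizer among complete allocations is one among all allocations
(`IsMNW.isFreeDisposalMNW`); hence lower bounds are only needed with free disposal.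

An optimal division has two properties. An agent who receives some of a good has the highest ratio
of value to utility for it (`IsOptimal.mul_utility_le`), and a good which somebody values is
divided completely (`IsOptimal.sum_eq_one`). The former yields prices at which every agent spends
one unit of money and gets her best value for money.

Upper bound (`misreport_utility_le`). Let `p` and `q` be the prices before and after a misreport by
agent `a`. Her utility ratio is at most what her new bundle costs at the prices `p`. Think of each
good as passing from its old to its new owners in proportion to their shares. Goods that some other
agent with non-increasing utility gives away satisfy `p ≤ q`, so what `a` receives of them costs
at most her new budget `1`. The agents `T` whose utility increases hold new bundles that each cost
more than `1` at the prices `p`, and these come only from `T` and from `a`, up to worthless parts.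
So what `a` receives from `T` costs at most what `a` gives to `T`; together with what she keeps,
this costs at most her old budget `1`. The total is at most `2`.

Lower bound (`exists_profitable_misreport`). On three equal cells, the first agent has values
`n, n - 1, 0` and the others `0, 1, n - 1`. A truthful first agent has to be content with the value
of the first cell (`utility_le_of_truthful`). If she claims that the first cell is worth only `ε`
times as much as the second, she still gets all of the first cell, as nobody else wants it, and all
but a fraction `ε` of the second (`share_ge_of_misreport`).
-/

namespace CakeCutting

/-! ### Linear Fisher markets -/

section Market

variable {ι κ : Type*} [Fintype ι] [Fintype κ]

/-- A division of unit amounts of the goods `κ` among the agents `ι`, possibly with leftovers. -/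
structure IsFeasible (z : ι → κ → ℝ) : Prop where
  nonneg : ∀ i k, 0 ≤ z i k
  sum_le : ∀ k, ∑ i, z i k ≤ 1

/-- The linear utility of agent `i`, whose value for the whole of good `k` is `w i k`. -/
def utility (w z : ι → κ → ℝ) (i : ι) : ℝ := ∑ k, w i k * z i k

/-- Every agent has nonnegative values for the goods, and values some good. -/
structure IsMarket (w : ι → κ → ℝ) : Prop where
  nonneg : ∀ i k, 0 ≤ w i k
  pos : ∀ i, 0 < ∑ k, w i k

/-- The division `z` maximizes the product of the utilities. -/
structure IsOptimal (w z : ι → κ → ℝ) : Prop where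
  feasible : IsFeasible z
  le : ∀ y, IsFeasible y → ∏ i, utility w y i ≤ ∏ i, utility w z i

lemma utility_nonneg {w z : ι → κ → ℝ} (hw : IsMarket w) (hz : IsFeasible z) (i : ι) :
    0 ≤ utility w z i :=
  Finset.sum_nonneg fun k _ => mul_nonneg (hw.nonneg i k) (hz.nonneg i k)

lemma utility_pos {w z : ι → κ → ℝ} (hw : IsMarket w) (hz : IsOptimal w z) (i : ι) :
    0 < utility w z i := by
  have hcard : (0 : ℝ) < Fintype.card ι := by
    exact_mod_cast Fintype.card_pos_iff.2 ⟨i⟩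
  -- the equal division gives every agent positive utility
  have hy : IsFeasible (fun (_ : ι) (_ : κ) => 1 / (Fintype.card ι : ℝ)) :=
    ⟨fun _ _ => by positivity, fun k => by simp [hcard.ne']⟩
  have hpos : 0 < ∏ j, utility w (fun (_ : ι) (_ : κ) => 1 / (Fintype.card ι : ℝ)) j := by
    refine Finset.prod_pos fun j _ => ?_
    rw [utility, ← Finset.sum_mul]
    exact mul_pos (hw.pos j) (by positivity)
  have hne := (hpos.trans_le (hz.le _ hy)).ne'
  exact (utility_nonneg hw hz.feasible i).lt_of_ne'
    (Finset.prod_ne_zero_iff.1 hne i (Finset.mem_univ i))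

lemma IsFeasible.le_one {α β : Type*} [Fintype α] {z : α → β → ℝ} (hz : IsFeasible z) (i : α)
    (k : β) : z i k ≤ 1 :=
  (Finset.single_le_sum (f := fun i => z i k) (fun j _ => hz.nonneg j k)
    (Finset.mem_univ i)).trans (hz.sum_le k)

/-- A good that somebody values is divided completely: handing her the leftovers would raise her
utility and with it the product. -/
lemma IsOptimal.sum_eq_one {w z : ι → κ → ℝ} (hw : IsMarket w) (hz : IsOptimal w z) {j : ι}
    {k : κ} (hjk : 0 < w j k) : ∑ i, z i k = 1 := by
  classical
  by_contra hne
  set s := 1 - ∑ i, z i k with hs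
  have hs0 : 0 < s := sub_pos.2 ((hz.feasible.sum_le k).lt_of_ne hne)
  let y : ι → κ → ℝ := fun i l => z i l + if i = j ∧ l = k then s else 0
  have hy : IsFeasible y := by
    refine ⟨fun i l => ?_, fun l => ?_⟩
    · have := hz.feasible.nonneg i l
      simp only [y]; split_ifs <;> linarith
    · simp only [y, Finset.sum_add_distrib]
      by_cases hl : l = k
      · subst hl; simp [hs]
      · simpa [hl] using hz.feasible.sum_le l
  have hu : ∀ i, utility w y i = utility w z i + if i = j then w j k * s else 0 := by
    intro i
    simp only [utility, y, mul_add, Finset.sum_add_distrib]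
    by_cases hi : i = j
    · subst hi; simp
    · simp [hi]
  have hlt : ∏ i, utility w z i < ∏ i, utility w y i := by
    refine Finset.prod_lt_prod (fun i _ => utility_pos hw hz i) (fun i _ => ?_)
      ⟨j, Finset.mem_univ j, ?_⟩
    · rw [hu]; split_ifs <;> nlinarith [mul_pos hjk hs0]
    · rw [hu]; simp [mul_pos hjk hs0]
  exact absurd (hz.le y hy) (not_le.2 hlt)

/-- First-order optimality: an agent who receives some of good `k` has the highest ratio of
value to utility for it. -/
lemma IsOptimal.mul_utility_le {w z : ι → κ → ℝ} (hw : IsMarket w) (hz : IsOptimal w z) {i : ι}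
    {k : κ} (hik : 0 < z i k) (j : ι) :
    w j k * utility w z i ≤ w i k * utility w z j := by
  classical
  rcases eq_or_ne i j with rfl | hij
  · exact le_rfl
  -- handing an amount `t` of good `k` from `i` to `j` does not increase the product
  have key : ∀ t, 0 ≤ t → t ≤ z i k →
      (utility w z i - w i k * t) * (utility w z j + w j k * t) ≤
        utility w z i * utility w z j := by
    intro t ht ht'
    let y : ι → κ → ℝ := fun a l =>
      z a l + if l = k then (if a = j then t else 0) - (if a = i then t else 0) else 0
    have hy : IsFeasible y := by
      refine ⟨fun a l => ?_, fun l => ?_⟩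
      · have := hz.feasible.nonneg a l
        simp only [y]
        split_ifs with h1 h2 h3 h3
        · linarith
        · linarith
        · subst h1 h3; linarith
        · linarith
        · linarith
      · simp only [y, Finset.sum_add_distrib]
        by_cases hl : l = k
        · subst hl; simpa using hz.feasible.sum_le l
        · simpa [hl] using hz.feasible.sum_le l
    have hu : ∀ a, utility w y a = utility w z a +
        w a k * ((if a = j then t else 0) - (if a = i then t else 0)) := by
      intro a
      simp [utility, y, mul_add, Finset.sum_add_distrib]
    have hle := hz.le y hy
    rw [← Finset.mul_prod_erase _ _ (Finset.mem_univ i),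
      ← Finset.mul_prod_erase _ _ (Finset.mem_univ i),
      ← Finset.mul_prod_erase (Finset.univ.erase i) _ (a := j) (by simp [hij.symm]),
      ← Finset.mul_prod_erase (Finset.univ.erase i) _ (a := j) (by simp [hij.symm])] at hle
    have hrest : ∏ a ∈ (Finset.univ.erase i).erase j, utility w y a =
        ∏ a ∈ (Finset.univ.erase i).erase j, utility w z a := by
      refine Finset.prod_congr rfl fun a ha => ?_
      simp only [Finset.mem_erase] at ha
      simp [hu, ha.1, ha.2.1]
    have hpos : 0 < ∏ a ∈ (Finset.univ.erase i).erase j, utility w z a :=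
      Finset.prod_pos fun a _ => utility_pos hw hz a
    rw [hrest, ← mul_assoc, ← mul_assoc] at hle
    have := le_of_mul_le_mul_right hle hpos
    simpa [hu, hij, hij.symm, sub_eq_add_neg] using this
  by_contra! hlt
  set d := w j k * utility w z i - w i k * utility w z j with hd
  have hd0 : 0 < d := sub_pos.2 hlt
  set c := w i k * w j k with hc
  have hc0 : 0 ≤ c := mul_nonneg (hw.nonneg i k) (hw.nonneg j k)
  -- the gain is `t * (d - c * t)`, positive for small `t`
  set t := min (z i k) (d / (c + 1)) with ht
  have ht0 : 0 < t := lt_min hik (by positivity)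
  have hct : c * t < d := by
    have h1 : t * (c + 1) ≤ d := (le_div_iff₀ (by positivity)).1 (min_le_right _ _)
    nlinarith
  have := key t ht0.le (min_le_left _ _)
  nlinarith [mul_pos ht0 (sub_pos.2 hct)]

/-- Equilibrium prices of an optimal division in which nothing is left over: no agent gets more
than value `utility w z i` per unit of money, every agent gets that much from what she receives,
and every agent spends one unit of money. -/
lemma IsOptimal.exists_price {w z : ι → κ → ℝ} (hw : IsMarket w) (hz : IsOptimal w z)
    (hsum : ∀ k, ∑ i, z i k = 1) :
    ∃ p : κ → ℝ, (∀ k, 0 ≤ p k) ∧ (∀ i k, w i k ≤ utility w z i * p k) ∧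
      (∀ i k, utility w z i * (p k * z i k) = w i k * z i k) ∧ ∀ i, ∑ k, p k * z i k = 1 := by
  have hu := utility_pos hw hz
  have hk : ∀ i j k, 0 < z i k → w j k / utility w z j ≤ w i k / utility w z i := by
    intro i j k hik
    rw [div_le_div_iff₀ (hu j) (hu i)]
    exact hz.mul_utility_le hw hik j
  have hz0 := hz.feasible.nonneg
  let p : κ → ℝ := fun k => ∑ i, w i k / utility w z i * z i k
  have h1 : ∀ i k, w i k / utility w z i ≤ p k := by
    intro i k
    calc w i k / utility w z i = ∑ j, w i k / utility w z i * z j k := by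
          rw [← Finset.mul_sum, hsum, mul_one]
      _ ≤ p k := Finset.sum_le_sum fun j _ => by
          rcases (hz0 j k).eq_or_lt with h | h
          · simp [← h]
          · exact mul_le_mul_of_nonneg_right (hk j i k h) h.le
  have h2 : ∀ i k, 0 < z i k → p k ≤ w i k / utility w z i := by
    intro i k hik
    calc p k ≤ ∑ j, w i k / utility w z i * z j k :=
          Finset.sum_le_sum fun j _ => mul_le_mul_of_nonneg_right (hk i j k hik) (hz0 j k)
      _ = w i k / utility w z i := by rw [← Finset.mul_sum, hsum, mul_one]
  have h3 : ∀ i k, utility w z i * (p k * z i k) = w i k * z i k := by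
    intro i k
    rcases (hz0 i k).eq_or_lt with h | h
    · simp [← h]
    · rw [le_antisymm (h2 i k h) (h1 i k), ← mul_assoc, mul_div_cancel₀ _ (hu i).ne']
  refine ⟨p, fun k => Finset.sum_nonneg fun i _ =>
    mul_nonneg (div_nonneg (hw.nonneg i k) (hu i).le) (hz0 i k), fun i k => ?_, h3, fun i => ?_⟩
  · rw [mul_comm]; exact (div_le_iff₀ (hu i)).1 (h1 i k)
  · have : utility w z i * ∑ k, p k * z i k = utility w z i * 1 := by
      rw [Finset.mul_sum, mul_one]
      exact Finset.sum_congr rfl fun k _ => h3 i k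
    exact mul_left_cancel₀ (hu i).ne' this

/-- In a linear Fisher market with equal budgets, an agent who misreports her values at most
doubles her utility.

Let `p`, `q` be the prices and `z`, `z'` the divisions for the true and the false report. The
spending `∑ k, p k * z' a k` of agent `a` on her new bundle at the old prices bounds the utility
ratio, and is estimated by splitting every good `k` into amounts `z' i k * z j k` that pass from
agent `j` to agent `i`. Prices of what leaves an agent whose utility does not increase are at most
the new prices. The agents `T` whose utility increases hold new bundles that cost more than their
budgets at the old prices, and can have received these only from `T` and `a`. -/
theorem misreport_utility_le {w w' z z' : ι → κ → ℝ} (hw : IsMarket w) (hw' : IsMarket w')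
    (hz : IsOptimal w z) (hz' : IsOptimal w' z') (hsum : ∀ k, ∑ i, z i k = 1)
    (hsum' : ∀ k, ∑ i, z' i k = 1) (a : ι) (hww' : ∀ i, i ≠ a → w' i = w i) :
    utility w z' a ≤ 2 * utility w z a := by
  classical
  have hu := utility_pos hw hz
  have hu' := utility_pos hw' hz'
  have hz0 := hz.feasible.nonneg
  have hz0' := hz'.feasible.nonneg
  obtain ⟨p, hp0, hp1, hp2, hp3⟩ := hz.exists_price hw hsum
  obtain ⟨q, hq0, hq1, hq2, hq3⟩ := hz'.exists_price hw' hsum'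
  set u := utility w z with hudef
  set u' := utility w' z' with hudef'
  -- the money value, at the old prices, of what passes from `j` to `i`
  let E : ι → ι → ℝ := fun i j => ∑ k, p k * (z' i k * z j k)
  have hE0 : ∀ i j, 0 ≤ E i j := fun i j => Finset.sum_nonneg fun k _ =>
    mul_nonneg (hp0 k) (mul_nonneg (hz0' i k) (hz0 j k))
  have hErow : ∀ i, ∑ j, E i j = ∑ k, p k * z' i k := by
    intro i
    simp only [E]
    rw [Finset.sum_comm]
    refine Finset.sum_congr rfl fun k _ => ?_
    rw [← Finset.mul_sum, ← Finset.mul_sum, hsum, mul_one]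
  have hEcol : ∀ j, ∑ i, E i j = 1 := by
    intro j
    simp only [E]
    rw [Finset.sum_comm, ← hp3 j]
    refine Finset.sum_congr rfl fun k _ => ?_
    rw [← Finset.mul_sum, ← Finset.sum_mul, hsum', one_mul]
  let T : Finset ι := Finset.univ.filter fun i => i ≠ a ∧ u i < u' i
  let L : Finset ι := Finset.univ.filter fun i => i ≠ a ∧ u' i ≤ u i
  have hsplit : ∀ f : ι → ℝ, ∑ i, f i = f a + ∑ i ∈ L, f i + ∑ i ∈ T, f i := by
    intro f
    rw [← Finset.add_sum_erase _ _ (Finset.mem_univ a), add_assoc]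
    congr 1
    have hLT : Disjoint L T := by
      rw [Finset.disjoint_left]
      intro i hi hi'
      simp only [L, T, Finset.mem_filter] at hi hi'
      exact absurd hi.2.2 (not_le.2 hi'.2.2)
    rw [← Finset.sum_union hLT]
    refine Finset.sum_congr ?_ fun _ _ => rfl
    ext i
    simp only [L, T, Finset.mem_erase, Finset.mem_union, Finset.mem_filter, Finset.mem_univ,
      true_and, and_true]
    rcases le_or_gt (u' i) (u i) with h | h
    · simp [h, not_lt.2 h]
    · simp [h, not_le.2 h]
  have hspend : ∀ i, utility w z' i ≤ u i * ∑ k, p k * z' i k := by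
    intro i
    rw [Finset.mul_sum]
    refine Finset.sum_le_sum fun k _ => ?_
    rw [← mul_assoc]
    exact mul_le_mul_of_nonneg_right (hp1 i k) (hz0' i k)
  have hueq : ∀ i, i ≠ a → utility w z' i = u' i := by
    intro i hi
    simp only [hudef', utility, hww' i hi]
  have hold : ∀ j, j ≠ a → ∀ k, u j * (p k * z j k) ≤ u' j * (q k * z j k) := by
    intro j hj k
    rw [hp2, ← mul_assoc, ← hww' j hj]
    exact mul_le_mul_of_nonneg_right (hq1 j k) (hz0 j k)
  have hnew : ∀ i, i ≠ a → ∀ k, u' i * (q k * z' i k) ≤ u i * (p k * z' i k) := by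
    intro i hi k
    rw [hq2, ← mul_assoc, hww' i hi]
    exact mul_le_mul_of_nonneg_right (hp1 i k) (hz0' i k)
  have hL : ∑ j ∈ L, E a j ≤ 1 := by
    calc ∑ j ∈ L, E a j ≤ ∑ j ∈ L, ∑ k, q k * (z' a k * z j k) := by
          refine Finset.sum_le_sum fun j hj => Finset.sum_le_sum fun k _ => ?_
          simp only [L, Finset.mem_filter] at hj
          have h1 : u j * (p k * z j k) ≤ u j * (q k * z j k) :=
            (hold j hj.2.1 k).trans (mul_le_mul_of_nonneg_right hj.2.2
              (mul_nonneg (hq0 k) (hz0 j k)))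
          have h2 := mul_le_mul_of_nonneg_left (le_of_mul_le_mul_left h1 (hu j)) (hz0' a k)
          linarith
      _ ≤ ∑ j, ∑ k, q k * (z' a k * z j k) :=
          Finset.sum_le_univ_sum_of_nonneg fun j => Finset.sum_nonneg fun k _ =>
            mul_nonneg (hq0 k) (mul_nonneg (hz0' a k) (hz0 j k))
      _ = 1 := by
          rw [Finset.sum_comm, ← hq3 a]
          refine Finset.sum_congr rfl fun k _ => ?_
          rw [← Finset.mul_sum, ← Finset.mul_sum, hsum, mul_one]
  have hTL : ∀ i ∈ T, ∑ j ∈ L, E i j = 0 := by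
    intro i hi
    refine Finset.sum_eq_zero fun j hj => Finset.sum_eq_zero fun k _ => ?_
    simp only [L, T, Finset.mem_filter] at hi hj
    -- `p ≤ q` on what `j` gives away, and `q < p` on what `i` receives unless both vanish
    have h1 : u j * (p k * z j k) ≤ u j * (q k * z j k) :=
      (hold j hj.2.1 k).trans (mul_le_mul_of_nonneg_right hj.2.2
        (mul_nonneg (hq0 k) (hz0 j k)))
    have h2 := mul_le_mul_of_nonneg_right (le_of_mul_le_mul_left h1 (hu j)) (hz0' i k)
    have h3 := mul_le_mul_of_nonneg_right (hnew i hi.2.1 k) (hz0 j k)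
    have h4 : 0 ≤ p k * (z' i k * z j k) := mul_nonneg (hp0 k) (mul_nonneg (hz0' i k) (hz0 j k))
    nlinarith [mul_le_mul_of_nonneg_left h2 (hu' i).le, hi.2.2]
  have hT : ∀ i ∈ T, 1 ≤ E i a + ∑ j ∈ T, E i j := by
    intro i hi
    have h1 := hsplit (E i)
    rw [hTL i hi, hErow, add_zero] at h1
    rw [← h1]
    simp only [T, Finset.mem_filter] at hi
    have h2 := hspend i
    rw [hueq i hi.2.1] at h2
    nlinarith [hu i, hi.2.2]
  have hTT : ∑ j ∈ T, E a j + ∑ i ∈ T, ∑ j ∈ T, E i j ≤ T.card := by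
    rw [Finset.sum_comm (s := T) (t := T) (f := E), ← Finset.sum_add_distrib]
    calc ∑ j ∈ T, (E a j + ∑ i ∈ T, E i j) ≤ ∑ j ∈ T, (1 : ℝ) := by
          refine Finset.sum_le_sum fun j _ => ?_
          rw [← hEcol j, hsplit fun i => E i j]
          have : 0 ≤ ∑ i ∈ L, E i j := Finset.sum_nonneg fun i _ => hE0 i j
          linarith
      _ = T.card := by simp
  have hTa : (T.card : ℝ) ≤ ∑ i ∈ T, E i a + ∑ i ∈ T, ∑ j ∈ T, E i j := by
    rw [← Finset.sum_add_distrib]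
    calc (T.card : ℝ) = ∑ i ∈ T, (1 : ℝ) := by simp
      _ ≤ _ := Finset.sum_le_sum hT
  have haa : E a a + ∑ i ∈ T, E i a ≤ 1 := by
    rw [← hEcol a, hsplit fun i => E i a]
    have : 0 ≤ ∑ i ∈ L, E i a := Finset.sum_nonneg fun i _ => hE0 i a
    linarith
  have hmain : ∑ k, p k * z' a k ≤ 2 := by
    rw [← hErow, hsplit (E a)]
    linarith
  calc utility w z' a ≤ u a * ∑ k, p k * z' a k := hspend a
    _ ≤ u a * 2 := mul_le_mul_of_nonneg_left hmain (hu a).le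
    _ = 2 * u a := mul_comm _ _

/-- Some division without leftovers maximizes the product of the utilities. -/
lemma exists_isOptimal [Nonempty ι] {w : ι → κ → ℝ} (hw : IsMarket w) :
    ∃ z, IsOptimal w z ∧ ∀ k, ∑ i, z i k = 1 := by
  classical
  let K : Set (ι → κ → ℝ) := {z | (∀ i k, 0 ≤ z i k) ∧ ∀ k, ∑ i, z i k = 1}
  have hKle : ∀ z ∈ K, ∀ i k, z i k ≤ 1 := fun z hz =>
    IsFeasible.le_one ⟨hz.1, fun k => (hz.2 k).le⟩
  have hK : IsCompact K := by
    refine (isCompact_Icc (a := (0 : ι → κ → ℝ)) (b := 1)).of_isClosed_subset ?_ fun z hz =>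
      ⟨fun i k => hz.1 i k, fun i k => hKle z hz i k⟩
    have h1 : IsClosed {z : ι → κ → ℝ | ∀ i k, 0 ≤ z i k} := by
      simp only [ofPred_forall]
      exact isClosed_iInter fun i => isClosed_iInter fun k =>
        isClosed_le continuous_const (by fun_prop)
    have h2 : IsClosed {z : ι → κ → ℝ | ∀ k, ∑ i, z i k = 1} := by
      simp only [ofPred_forall]
      exact isClosed_iInter fun k => isClosed_eq (by fun_prop) continuous_const
    exact h1.inter h2
  obtain ⟨a⟩ := ‹Nonempty ι›
  have hne : K.Nonempty :=
    ⟨fun i _ => if i = a then 1 else 0, fun i k => by dsimp only; split_ifs <;> norm_num,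
      fun k => by simp⟩
  obtain ⟨z, hzK, hz⟩ := hK.exists_isMaxOn hne
    (f := fun z => ∏ i, utility w z i) (by unfold utility; fun_prop)
  refine ⟨z, ⟨⟨hzK.1, fun k => (hzK.2 k).le⟩, fun y hy => ?_⟩, hzK.2⟩
  -- hand the leftovers of `y` to agent `a`
  let y' : ι → κ → ℝ := fun i k => y i k + if i = a then 1 - ∑ j, y j k else 0
  have hyy' : ∀ i k, y i k ≤ y' i k := by
    intro i k
    have := hy.sum_le k
    simp only [y']; split_ifs <;> linarith
  have hy' : y' ∈ K := ⟨fun i k => (hy.nonneg i k).trans (hyy' i k), fun k => by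
    simp [y', Finset.sum_add_distrib]⟩
  refine le_trans (Finset.prod_le_prod (fun i _ => utility_nonneg hw hy i) fun i _ => ?_) (hz hy')
  exact Finset.sum_le_sum fun k _ => mul_le_mul_of_nonneg_left (hyy' i k) (hw.nonneg i k)

end Market

/-! ### Grids -/

/-- The intervals `[a k, b k]` subdivide the cake into cells of positive length. -/
structure IsGrid {κ : Type*} (a b : κ → ℝ) : Prop where
  lt : ∀ k, a k < b k
  disjoint : ∀ k l, k ≠ l → Disjoint (Ioo (a k) (b k)) (Ioo (a l) (b l))
  iUnion_Icc : ⋃ k, Icc (a k) (b k) = cake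

/-- The density `f` has the constant value `c k` inside the cell `k`. -/
def IsStepOn {κ : Type*} (a b : κ → ℝ) (f : Density) (c : κ → ℝ) : Prop :=
  ∀ k, ∀ x ∈ Ioo (a k) (b k), f.toFun x = c k

section Grid

variable {κ : Type*} {a b : κ → ℝ}

lemma IsGrid.Icc_subset (h : IsGrid a b) (k : κ) : Icc (a k) (b k) ⊆ cake :=
  h.iUnion_Icc ▸ subset_iUnion (fun k => Icc (a k) (b k)) k

lemma IsGrid.zero_le (h : IsGrid a b) (k : κ) : 0 ≤ a k :=
  (h.Icc_subset k (left_mem_Icc.2 (h.lt k).le)).1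

lemma IsGrid.le_one (h : IsGrid a b) (k : κ) : b k ≤ 1 :=
  (h.Icc_subset k (right_mem_Icc.2 (h.lt k).le)).2

lemma IsGrid.disjoint_Ioo_Icc (h : IsGrid a b) {k l : κ} (hkl : k ≠ l) :
    Disjoint (Ioo (a k) (b k)) (Icc (a l) (b l)) := by
  rw [← closure_Ioo (h.lt l).ne]
  exact (h.disjoint k l hkl).closure_right isOpen_Ioo

lemma IsGrid.volume_Icc_inter (h : IsGrid a b) {k l : κ} (hkl : k ≠ l) :
    volume (Icc (a k) (b k) ∩ Icc (a l) (b l)) = 0 := by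
  have h1 : (Icc (a k) (b k) ∩ Icc (a l) (b l) : Set ℝ) =ᵐ[volume]
      (Ioo (a k) (b k) ∩ Icc (a l) (b l) : Set ℝ) := Ioo_ae_eq_Icc.symm.inter (ae_eq_refl _)
  rw [measure_congr h1, (h.disjoint_Ioo_Icc hkl).inter_eq, measure_empty]

lemma IsStepOn.coeff_nonneg {f : Density} {c : κ → ℝ} (h : IsGrid a b) (hf : IsStepOn a b f c)
    (k : κ) : 0 ≤ c k := by
  obtain ⟨x, hx⟩ := exists_between (h.lt k)
  exact hf k x hx ▸ f.nonneg x

/-- Off the finitely many end points of the cells, a step function is a sum of indicators. -/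
lemma IsStepOn.ae_eq [Fintype κ] {f : Density} {c : κ → ℝ} (h : IsGrid a b)
    (hf : IsStepOn a b f c) :
    f.toFun =ᵐ[volume] fun x => ∑ k, (Ioo (a k) (b k)).indicator (fun _ => c k) x := by
  classical
  have hfin : volume (range a ∪ range b) = 0 :=
    ((finite_range a).union (finite_range b)).measure_zero _
  filter_upwards [compl_mem_ae_iff.2 hfin] with x hx
  by_cases hxc : x ∈ cake
  · rw [← h.iUnion_Icc, mem_iUnion] at hxc
    obtain ⟨k, hk⟩ := hxc
    have hxk : x ∈ Ioo (a k) (b k) :=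
      ⟨hk.1.lt_of_ne fun e => hx (Or.inl ⟨k, e⟩), hk.2.lt_of_ne fun e => hx (Or.inr ⟨k, e.symm⟩)⟩
    rw [Finset.sum_eq_single k, indicator_of_mem hxk, hf k x hxk]
    · intro l _ hlk
      exact indicator_of_notMem (fun hl => disjoint_left.1 (h.disjoint l k hlk) hl hxk) _
    · simp
  · rw [f.zero_off x hxc, eq_comm]
    exact Finset.sum_eq_zero fun k _ =>
      indicator_of_notMem (fun hk => hxc (h.Icc_subset k (Ioo_subset_Icc_self hk))) _

lemma IsStepOn.value_eq [Fintype κ] {f : Density} {c : κ → ℝ} (h : IsGrid a b)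
    (hf : IsStepOn a b f c) {S : Set ℝ} (hS : volume S ≠ ∞) :
    value f S = ∑ k, c k * volume.real (Ioo (a k) (b k) ∩ S) := by
  rw [value, integral_congr_ae (ae_restrict_of_ae (hf.ae_eq h)), integral_finsetSum]
  · refine Finset.sum_congr rfl fun k _ => ?_
    rw [integral_indicator_const _ measurableSet_Ioo, measureReal_restrict_apply measurableSet_Ioo,
      smul_eq_mul, mul_comm]
  · intro k _
    have : IsFiniteMeasure (volume.restrict S) := ⟨by simpa using hS.lt_top⟩
    exact (integrable_const _).indicator measurableSet_Ioo

end Grid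

/-- A density is constant on intervals that avoid a certain finite set of points. -/
lemma Density.exists_breakpoints (f : Density) : ∃ P : Finset ℝ, ∀ y ∈ cake, ∀ z ∈ cake, y ≤ z →
    (∀ x ∈ P, x ∉ Icc y z) → f.toFun y = f.toFun z := by
  classical
  obtain ⟨m, X, hX, -, hU, hc⟩ := f.piecewiseConstant
  refine ⟨Finset.univ.image fun t => sSup (X t), fun y hy z hz hyz hP => ?_⟩
  have hXc : ∀ t, X t ⊆ cake := fun t => hU ▸ subset_iUnion X t
  obtain ⟨t, ht⟩ := mem_iUnion.1 (hU ▸ hy : y ∈ ⋃ t, X t)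
  obtain ⟨c, hct⟩ := hc t
  by_cases hzt : z ∈ X t
  · rw [hct y ht, hct z hzt]
  -- the part `X t` ends between `y` and `z`
  · refine absurd ?_ (hP (sSup (X t)) (Finset.mem_image_of_mem _ (Finset.mem_univ t)))
    refine ⟨le_csSup ⟨1, fun x hx => (hXc t hx).2⟩ ht, csSup_le ⟨y, ht⟩ fun x hx => ?_⟩
    by_contra! hlt
    exact hzt ((hX t).out ht hx ⟨hyz, hlt.le⟩)

/-- The cells between consecutive points of a finite set that contains the end points of the
cake. -/
lemma exists_grid_of_finset (P : Finset ℝ) (h0 : 0 ∈ P) (h1 : 1 ∈ P) (hP : ∀ x ∈ P, x ∈ cake) :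
    ∃ (m : ℕ) (a b : Fin m → ℝ), IsGrid a b ∧ ∀ k, ∀ x ∈ P, x ∉ Ioo (a k) (b k) := by
  classical
  have hcard : 0 < P.card := Finset.card_pos.2 ⟨0, h0⟩
  obtain ⟨m, hm⟩ : ∃ m, P.card = m + 1 := ⟨P.card - 1, by omega⟩
  let e := P.orderEmbOfFin hm
  have hmem : ∀ x ∈ P, ∃ k, e k = x := by
    intro x hx
    have : x ∈ range e := by
      simp only [e, Finset.range_orderEmbOfFin]; exact hx
    exact this
  have heP : ∀ k, e k ∈ P := fun k => Finset.orderEmbOfFin_mem P hm k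
  have hout : ∀ (k : Fin m), ∀ x ∈ P, x ∉ Ioo (e k.castSucc) (e k.succ) := by
    intro k x hx hxk
    obtain ⟨l, rfl⟩ := hmem x hx
    have h1 := e.lt_iff_lt.1 hxk.1
    have h2 := e.lt_iff_lt.1 hxk.2
    rw [Fin.lt_def] at h1 h2
    simp at h1 h2
    omega
  refine ⟨m, fun k => e k.castSucc, fun k => e k.succ, ⟨fun k => ?_, ?_, ?_⟩, hout⟩
  · exact e.lt_iff_lt.2 (Fin.castSucc_lt_succ)
  · have key : ∀ k l : Fin m, k < l →
        Disjoint (Ioo (e k.castSucc) (e k.succ)) (Ioo (e l.castSucc) (e l.succ)) := by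
      intro k l hkl
      rw [disjoint_left]
      intro x hx hx'
      have : e k.succ ≤ e l.castSucc := e.le_iff_le.2 (by
        rw [Fin.le_def]; simp; exact hkl)
      linarith [hx.2, hx'.1]
    intro k l hkl
    rcases lt_or_gt_of_ne hkl with h | h
    · exact key k l h
    · exact (key l k h).symm
  · refine Subset.antisymm (iUnion_subset fun k x hx => ?_) fun x hx => ?_
    · exact ⟨(hP _ (heP _)).1.trans hx.1, hx.2.trans (hP _ (heP _)).2⟩
    · obtain ⟨l0, hl0⟩ := hmem 0 h0
      obtain ⟨l1, hl1⟩ := hmem 1 h1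
      rw [mem_iUnion]
      by_contra! hno
      -- otherwise, by induction along the points, `x` lies beyond the last of them
      have hind : ∀ k : Fin (m + 1), e k ≤ x ∧ (0 < k → e k < x) := by
        intro k
        induction k using Fin.induction with
        | zero =>
          refine ⟨?_, fun h => absurd h (lt_irrefl _)⟩
          exact ((e.le_iff_le.2 (Fin.zero_le l0)).trans hl0.le).trans hx.1
        | succ k ih =>
          have : e k.succ < x := by
            by_contra! hle
            exact hno k ⟨ih.1, hle⟩
          exact ⟨this.le, fun _ => this⟩
      have h10 : 0 < l1 := by
        rw [Fin.pos_iff_ne_zero]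
        rintro rfl
        have := e.le_iff_le.2 (Fin.zero_le l0)
        linarith
      have := (hind l1).2 h10
      linarith [hx.2]

/-- Finitely many densities are step functions on a common grid. -/
lemma exists_grid {ι : Type*} [Fintype ι] (f : ι → Density) :
    ∃ (m : ℕ) (a b : Fin m → ℝ) (c : ι → Fin m → ℝ), IsGrid a b ∧
      ∀ i, IsStepOn a b (f i) (c i) := by
  classical
  choose Q hQ using fun i => (f i).exists_breakpoints
  let P : Finset ℝ := insert 0 (insert 1 ((Finset.univ.biUnion Q).filter (· ∈ cake)))
  obtain ⟨m, a, b, hab, hP⟩ := exists_grid_of_finset P (by simp [P]) (by simp [P]) (by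
    intro x hx
    simp only [P, Finset.mem_insert, Finset.mem_filter] at hx
    rcases hx with rfl | rfl | hx
    · simp [cake]
    · simp [cake]
    · exact hx.2)
  have hconst : ∀ i k, ∀ y ∈ Ioo (a k) (b k), ∀ z ∈ Ioo (a k) (b k), y ≤ z →
      (f i).toFun y = (f i).toFun z := by
    intro i k y hy z hz hyz
    have hyc := hab.Icc_subset k (Ioo_subset_Icc_self hy)
    have hzc := hab.Icc_subset k (Ioo_subset_Icc_self hz)
    refine hQ i y hyc z hzc hyz fun x hx hxyz => hP k x ?_ ⟨hy.1.trans_le hxyz.1,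
      hxyz.2.trans_lt hz.2⟩
    simp only [P, Finset.mem_insert, Finset.mem_filter, Finset.mem_biUnion, Finset.mem_univ,
      true_and]
    exact Or.inr (Or.inr ⟨⟨i, hx⟩, hyc.1.trans hxyz.1, hxyz.2.trans hzc.2⟩)
  refine ⟨m, a, b, fun i k => (f i).toFun ((a k + b k) / 2), hab, fun i k x hx => ?_⟩
  have hmid : (a k + b k) / 2 ∈ Ioo (a k) (b k) := by
    have := hab.lt k
    constructor <;> linarith
  rcases le_total x ((a k + b k) / 2) with h | h
  · exact hconst i k _ hx _ hmid h
  · exact (hconst i k _ hmid _ hx h).symm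

/-! ### Allocations and divisions -/

lemma IsBundle.isClosed {S : Set ℝ} (h : IsBundle S) : IsClosed S := by
  obtain ⟨k, a, b, -, rfl⟩ := h
  exact isClosed_iUnion_of_finite fun _ => isClosed_Icc

lemma IsBundle.subset_cake {S : Set ℝ} (h : IsBundle S) : S ⊆ cake := by
  obtain ⟨k, a, b, hab, rfl⟩ := h
  exact iUnion_subset fun j => Icc_subset_Icc (hab j).1 (hab j).2.2

lemma IsBundle.volume_ne_top {S : Set ℝ} (h : IsBundle S) : volume S ≠ ∞ :=
  ((measure_mono h.subset_cake).trans_lt (by simp [cake])).ne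

lemma isBundle_iUnion {τ : Type*} [Finite τ] (a b : τ → ℝ)
    (h : ∀ j, 0 ≤ a j ∧ a j < b j ∧ b j ≤ 1) : IsBundle (⋃ j, Icc (a j) (b j)) := by
  obtain ⟨k, ⟨e⟩⟩ := Finite.exists_equiv_fin τ
  exact ⟨k, a ∘ e.symm, b ∘ e.symm, fun j => h _,
    (e.symm.surjective.iUnion_comp fun j => Icc (a j) (b j)).symm⟩

section Division

variable {n : ℕ} {κ : Type*} {a b : κ → ℝ}

/-- The fraction of cell `k` that agent `i` receives. -/
noncomputable def share (a b : κ → ℝ) (A : Fin n → Set ℝ) (i : Fin n) (k : κ) : ℝ :=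
  volume.real (Ioo (a k) (b k) ∩ A i) / (b k - a k)

/-- The market whose goods are the cells of a grid, for densities with values `c i k`. -/
def cellValue (a b : κ → ℝ) (c : Fin n → κ → ℝ) (i : Fin n) (k : κ) : ℝ := c i k * (b k - a k)

lemma IsStepOn.value_eq_utility [Fintype κ] (h : IsGrid a b) {f : Fin n → Density}
    {c : Fin n → κ → ℝ} {i : Fin n} (hf : IsStepOn a b (f i) (c i)) {A : Fin n → Set ℝ} (hA : IsBundle (A i)) :
    value (f i) (A i) = utility (cellValue a b c) (share a b A) i := by
  rw [hf.value_eq h hA.volume_ne_top, utility]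
  refine Finset.sum_congr rfl fun k _ => ?_
  have := (sub_pos.2 (h.lt k)).ne'
  rw [cellValue, share]
  field_simp

lemma sum_share (a b : κ → ℝ) {A : Fin n → Set ℝ} (hA : IsAllocation A) (k : κ) :
    ∑ i, share a b A i k = volume.real (Ioo (a k) (b k) ∩ ⋃ i, A i) / (b k - a k) := by
  simp only [share]
  rw [← Finset.sum_div, inter_iUnion]
  congr 1
  simp only [measureReal_def]
  rw [measure_iUnion₀, tsum_fintype, ENNReal.toReal_sum]
  · exact fun i _ => ((measure_mono inter_subset_right).trans_lt
      (hA.1 i).volume_ne_top.lt_top).ne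
  · intro i j hij
    exact measure_mono_null (inter_subset_inter inter_subset_right inter_subset_right)
      (hA.2 i j hij)
  · exact fun i => (measurableSet_Ioo.inter (hA.1 i).isClosed.measurableSet).nullMeasurableSet

lemma IsAllocation.isFeasible_share (h : IsGrid a b) {A : Fin n → Set ℝ} (hA : IsAllocation A) :
    IsFeasible (share a b A) := by
  refine ⟨fun i k => div_nonneg measureReal_nonneg (sub_pos.2 (h.lt k)).le, fun k => ?_⟩
  rw [sum_share a b hA, div_le_one (sub_pos.2 (h.lt k))]
  refine (measureReal_mono inter_subset_left (by simp)).trans ?_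
  rw [Real.volume_real_Ioo_of_le (h.lt k).le]

lemma IsCompleteAllocation.sum_share (h : IsGrid a b) {A : Fin n → Set ℝ}
    (hA : IsCompleteAllocation A) (k : κ) : ∑ i, share a b A i k = 1 := by
  rw [CakeCutting.sum_share a b hA.1, hA.2,
    inter_eq_left.2 (Ioo_subset_Icc_self.trans (h.Icc_subset k)),
    Real.volume_real_Ioo_of_le (h.lt k).le, div_self (sub_pos.2 (h.lt k)).ne']

variable [Fintype κ]

lemma isMarket_cellValue (h : IsGrid a b) {f : Fin n → Density} {c : Fin n → κ → ℝ}
    (hf : ∀ i, IsStepOn a b (f i) (c i)) : IsMarket (cellValue a b c) := by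
  refine ⟨fun i k => mul_nonneg ((hf i).coeff_nonneg h k) (sub_pos.2 (h.lt k)).le, fun i => ?_⟩
  have h1 : value (f i) cake = ∑ k, cellValue a b c i k := by
    rw [(hf i).value_eq h (by simp [cake])]
    refine Finset.sum_congr rfl fun k _ => ?_
    rw [inter_eq_left.2 (Ioo_subset_Icc_self.trans (h.Icc_subset k)),
      Real.volume_real_Ioo_of_le (h.lt k).le, cellValue]
  exact h1 ▸ (f i).pos

/-- Every division without leftovers of the cells of a grid comes from a complete allocation: cut
each cell into consecutive intervals whose lengths are given by the shares. -/
lemma exists_share_eq (h : IsGrid a b) {z : Fin n → κ → ℝ} (hz0 : ∀ i k, 0 ≤ z i k)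
    (hz : ∀ k, ∑ i, z i k = 1) : ∃ A : Fin n → Set ℝ, IsCompleteAllocation A ∧
      share a b A = z := by
  classical
  let s : κ → ℕ → ℝ := fun k r => ∑ j ∈ Finset.univ.filter (fun j : Fin n => j.val < r), z j k
  have hs_succ : ∀ k (i : Fin n), s k (i + 1) = s k i + z i k := by
    intro k i
    have : (Finset.univ.filter fun j : Fin n => j.val < i + 1) =
        insert i (Finset.univ.filter fun j : Fin n => j.val < i) := by
      ext j; simp [Fin.ext_iff]; omega
    simp only [s]
    rw [this, Finset.sum_insert (by simp), add_comm]
  have hs_zero : ∀ k, s k 0 = 0 := fun k => by simp [s]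
  have hs_n : ∀ k, s k n = 1 := fun k => by simp [s, hz]
  have hs_mono : ∀ k, Monotone (s k) := fun k r r' hr =>
    Finset.sum_le_sum_of_subset_of_nonneg (fun j hj => by
      simp only [Finset.mem_filter, Finset.mem_univ, true_and] at hj ⊢; omega) fun j _ _ => hz0 j k
  -- the share of agent `r` in cell `k` reaches from `x k r` to `x k (r + 1)`
  let x : κ → ℕ → ℝ := fun k r => a k + s k r * (b k - a k)
  have hx_mono : ∀ k, Monotone (x k) := fun k r r' hr => by
    have := mul_le_mul_of_nonneg_right (hs_mono k hr) (sub_pos.2 (h.lt k)).le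
    simp only [x]; linarith
  have hx_zero : ∀ k, x k 0 = a k := fun k => by simp [x, hs_zero]
  have hx_n : ∀ k, x k n = b k := fun k => by simp [x, hs_n]
  have hx_succ : ∀ k (i : Fin n), x k (i + 1) = x k i + z i k * (b k - a k) := fun k i => by
    simp only [x, hs_succ]; ring
  have hax : ∀ k r, a k ≤ x k r := fun k r => hx_zero k ▸ hx_mono k (Nat.zero_le r)
  have hxb : ∀ k r, r ≤ n → x k r ≤ b k := fun k r hr => hx_n k ▸ hx_mono k hr
  have hsub : ∀ k (i : Fin n), Icc (x k i) (x k (i + 1)) ⊆ Icc (a k) (b k) := fun k i =>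
    Icc_subset_Icc (hax k _) (hxb k _ i.2)
  let A : Fin n → Set ℝ := fun i => ⋃ k : {k // 0 < z i k}, Icc (x k i) (x k (i + 1))
  have hA : ∀ i, IsBundle (A i) := by
    refine fun i => isBundle_iUnion _ _ fun k => ⟨(h.zero_le k).trans (hax k _), ?_,
      (hxb k _ i.2).trans (h.le_one k)⟩
    rw [hx_succ]
    exact lt_add_of_pos_right _ (mul_pos k.2 (sub_pos.2 (h.lt k)))
  have hlt : ∀ i j, i < j → volume (A i ∩ A j) = 0 := by
    intro i j hij
    simp only [A, iUnion_inter, inter_iUnion]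
    refine measure_iUnion_null fun l => measure_iUnion_null fun k => ?_
    rcases eq_or_ne k.1 l.1 with hkl | hkl
    · refine measure_mono_null (t := {x k j}) (fun y hy => ?_) (by simp)
      rw [hkl] at hy ⊢
      exact le_antisymm (hy.1.2.trans (hx_mono l (Nat.succ_le_of_lt (Fin.lt_def.1 hij)))) hy.2.1
    · exact measure_mono_null (inter_subset_inter (hsub _ _) (hsub _ _)) (h.volume_Icc_inter hkl)
  refine ⟨A, ⟨⟨hA, fun i j hij => ?_⟩, ?_⟩, ?_⟩
  · rcases lt_or_gt_of_ne hij with hij | hij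
    · exact hlt i j hij
    · rw [inter_comm]; exact hlt j i hij
  · refine Subset.antisymm (iUnion_subset fun i => (hA i).subset_cake) ?_
    rw [← h.iUnion_Icc]
    refine iUnion_subset fun k => ?_
    -- the union is closed, so that only points right of the left end have to be found in it
    rw [← closure_Ioc (h.lt k).ne]
    refine closure_minimal (fun y hy => ?_) (isClosed_iUnion_of_finite fun i => (hA i).isClosed)
    have hex : ∃ r, y ≤ x k r := ⟨n, by rw [hx_n]; exact hy.2⟩
    have hr := Nat.find_spec hex
    have hmin := fun r => Nat.find_min hex (m := r)
    have hrn : Nat.find hex ≤ n := Nat.find_min' hex (by rw [hx_n]; exact hy.2)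
    obtain ⟨r, hr'⟩ : ∃ r, Nat.find hex = r + 1 := by
      refine Nat.exists_eq_succ_of_ne_zero fun h0 => ?_
      rw [h0, hx_zero] at hr
      exact absurd hy.1 (not_lt.2 hr)
    have hlt' : x k r < y := not_le.1 (hmin r (by omega))
    rw [hr'] at hr hrn
    let i : Fin n := ⟨r, hrn⟩
    have hzi : 0 < z i k := by
      have h1 : x k (r + 1) = x k r + z i k * (b k - a k) := hx_succ k i
      exact pos_of_mul_pos_left (by linarith) (sub_pos.2 (h.lt k)).le
    exact mem_iUnion.2 ⟨i, mem_iUnion.2 ⟨⟨k, hzi⟩, hlt'.le, hr⟩⟩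
  · ext i k
    rw [share, div_eq_iff (sub_pos.2 (h.lt k)).ne']
    have h1 : (Ioo (a k) (b k) ∩ A i : Set ℝ) =ᵐ[volume]
        (Icc (x k i) (x k (i + 1)) ∩ {_y | 0 < z i k} : Set ℝ) := by
      have h2 : Ioo (a k) (b k) ∩ A i =
          Ioo (a k) (b k) ∩ (Icc (x k i) (x k (i + 1)) ∩ {_y | 0 < z i k}) := by
        ext y
        simp only [A, mem_inter_iff, mem_iUnion, mem_ofPred_eq]
        refine and_congr_right fun hy => ⟨?_, fun hy' => ⟨⟨k, hy'.2⟩, hy'.1⟩⟩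
        rintro ⟨⟨l, hl⟩, hyl⟩
        rcases eq_or_ne k l with rfl | hkl
        · exact ⟨hyl, hl⟩
        · exact absurd (hsub l i hyl) (disjoint_left.1 (h.disjoint_Ioo_Icc hkl) hy)
      have h3 : Icc (a k) (b k) ∩ (Icc (x k i) (x k (i + 1)) ∩ {_y | 0 < z i k}) =
          Icc (x k i) (x k (i + 1)) ∩ {_y | 0 < z i k} :=
        inter_eq_right.2 (inter_subset_left.trans (hsub k i))
      rw [h2]
      exact (Ioo_ae_eq_Icc.inter (ae_eq_refl _)).trans (Filter.EventuallyEq.of_eq h3)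
    rw [measureReal_congr h1]
    rcases (hz0 i k).eq_or_lt with hzi | hzi
    · simp [← hzi]
    · simp only [hzi, ofPred_true, inter_univ]
      rw [Real.volume_real_Icc_of_le (hx_mono k (Nat.le_succ _)), hx_succ]
      ring

lemma exists_allocation_value_ge (h : IsGrid a b) {f : Fin n → Density} {c : Fin n → κ → ℝ}
    (hf : ∀ i, IsStepOn a b (f i) (c i)) (i₀ : Fin n) {z : Fin n → κ → ℝ} (hz : IsFeasible z) :
    ∃ A : Fin n → Set ℝ, IsCompleteAllocation A ∧
      ∀ i, utility (cellValue a b c) z i ≤ value (f i) (A i) := by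
  classical
  -- hand the leftovers to agent `i₀`
  let y : Fin n → κ → ℝ := fun i k => z i k + if i = i₀ then 1 - ∑ j, z j k else 0
  have hzy : ∀ i k, z i k ≤ y i k := by
    intro i k
    have := hz.sum_le k
    simp only [y]; split_ifs <;> linarith
  obtain ⟨A, hA, hAy⟩ := exists_share_eq h (fun i k => (hz.nonneg i k).trans (hzy i k))
    (fun k => by simp [y, Finset.sum_add_distrib])
  refine ⟨A, hA, fun i => ?_⟩
  rw [(hf i).value_eq_utility h (hA.1.1 i), hAy]
  exact Finset.sum_le_sum fun k _ =>
    mul_le_mul_of_nonneg_left (hzy i k) ((isMarket_cellValue h hf).nonneg i k)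

lemma value_nonneg (f : Density) (S : Set ℝ) : 0 ≤ value f S :=
  integral_nonneg f.nonneg

lemma nashWelfare_le_iff (hn : 1 ≤ n) (f : Fin n → Density) (A B : Fin n → Set ℝ) :
    nashWelfare f A ≤ nashWelfare f B ↔ ∏ i, value (f i) (A i) ≤ ∏ i, value (f i) (B i) :=
  Real.rpow_le_rpow_iff (Finset.prod_nonneg fun _ _ => value_nonneg _ _)
    (Finset.prod_nonneg fun _ _ => value_nonneg _ _) (by positivity)

/-- Discarding pieces is never needed for maximal Nash welfare. -/
lemma IsMNW.isFreeDisposalMNW (hn : 1 ≤ n) {f : Fin n → Density} {A : Fin n → Set ℝ}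
    (hA : IsMNW f A) : IsFreeDisposalMNW f A := by
  obtain ⟨m, a, b, c, h, hf⟩ := exists_grid f
  refine ⟨hA.1.1, fun B hB => ?_⟩
  obtain ⟨C, hC, hle⟩ := exists_allocation_value_ge h hf ⟨0, hn⟩ (hB.isFeasible_share h)
  refine le_trans ((nashWelfare_le_iff hn f B C).2 ?_) (hA.2 C hC)
  refine Finset.prod_le_prod (fun _ _ => value_nonneg _ _) fun i _ => ?_
  rw [(hf i).value_eq_utility h (hB.1 i)]
  exact hle i

lemma IsFreeDisposalMNW.isOptimal (hn : 1 ≤ n) (h : IsGrid a b) {f : Fin n → Density}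
    {c : Fin n → κ → ℝ} (hf : ∀ i, IsStepOn a b (f i) (c i)) {A : Fin n → Set ℝ}
    (hA : IsFreeDisposalMNW f A) : IsOptimal (cellValue a b c) (share a b A) := by
  refine ⟨hA.1.isFeasible_share h, fun y hy => ?_⟩
  obtain ⟨B, hB, hle⟩ := exists_allocation_value_ge h hf ⟨0, hn⟩ hy
  have h1 := (nashWelfare_le_iff hn f B A).1 (hA.2 B hB.1)
  rw [Finset.prod_congr rfl fun i _ => (hf i).value_eq_utility h (hA.1.1 i)] at h1
  exact (Finset.prod_le_prod (fun i _ => utility_nonneg (isMarket_cellValue h hf) hy i)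
    fun i _ => hle i).trans h1

end Division

lemma exists_isMNW {n : ℕ} (hn : 1 ≤ n) (f : Fin n → Density) : ∃ A, IsMNW f A := by
  obtain ⟨m, a, b, c, h, hf⟩ := exists_grid f
  have : Nonempty (Fin n) := ⟨⟨0, hn⟩⟩
  obtain ⟨z, hz, hsum⟩ := exists_isOptimal (isMarket_cellValue h hf)
  obtain ⟨A, hA, rfl⟩ := exists_share_eq h hz.feasible.nonneg hsum
  refine ⟨A, hA, fun B hB => (nashWelfare_le_iff hn f B A).2 ?_⟩
  rw [Finset.prod_congr rfl fun i _ => (hf i).value_eq_utility h (hA.1.1 i),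
    Finset.prod_congr rfl fun i _ => (hf i).value_eq_utility h (hB.1.1 i)]
  exact hz.le _ (hB.1.isFeasible_share h)

/-! ### The market with three goods -/

section ThreeGoods

variable {ι : Type*} [Fintype ι] {w z : ι → Fin 3 → ℝ} {i₀ : ι} {N : ℝ}

/-- With truthful reports, agent `i₀` gets no more than the first good is worth to her. -/
lemma utility_le_of_truthful (hcard : (Fintype.card ι : ℝ) = N)
    (h₀ : w i₀ = ![N / 3, (N - 1) / 3, 0]) (h : ∀ i ≠ i₀, w i = ![0, 1 / 3, (N - 1) / 3])
    (hw : IsMarket w) (hz : IsOptimal w z) : utility w z i₀ ≤ N / 3 := by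
  classical
  have hN : 1 ≤ N := by
    rw [← hcard]; exact_mod_cast Fintype.card_pos_iff.2 ⟨i₀⟩
  by_contra! hlt
  have hu₀ : utility w z i₀ = N / 3 * z i₀ 0 + (N - 1) / 3 * z i₀ 1 := by
    simp [utility, Fin.sum_univ_three, h₀]
  have hz0 := hz.feasible.nonneg
  have h1 : 0 < (N - 1) * z i₀ 1 := by
    have := hz.feasible.le_one i₀ 0
    nlinarith
  have hN1 : 0 < N - 1 := pos_of_mul_pos_left h1 (hz0 i₀ 1)
  have hz1 : 0 < z i₀ 1 := pos_of_mul_pos_right h1 hN1.le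
  -- agent `i₀` takes some of the second good, so the utilities of the others are large
  have hj : ∀ j ∈ Finset.univ.erase i₀, utility w z i₀ / (N - 1) ≤ utility w z j := by
    intro j hj
    have := hz.mul_utility_le hw hz1 j
    rw [h j (Finset.ne_of_mem_erase hj), h₀] at this
    simp only [Matrix.cons_val_one, Matrix.cons_val_zero] at this
    rw [div_le_iff₀ hN1]
    linarith
  have hcard' : ((Finset.univ.erase i₀).card : ℝ) = N - 1 := by
    rw [Finset.card_erase_of_mem (Finset.mem_univ _), Finset.card_univ,
      Nat.cast_sub (Fintype.card_pos_iff.2 ⟨i₀⟩), hcard, Nat.cast_one]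
  have hle := Finset.sum_le_sum hj
  rw [Finset.sum_const, nsmul_eq_mul, hcard', mul_div_cancel₀ _ hN1.ne'] at hle
  have hsum : ∑ j ∈ Finset.univ.erase i₀, utility w z j =
      1 / 3 * ∑ j ∈ Finset.univ.erase i₀, z j 1 +
        (N - 1) / 3 * ∑ j ∈ Finset.univ.erase i₀, z j 2 := by
    rw [Finset.mul_sum, Finset.mul_sum, ← Finset.sum_add_distrib]
    refine Finset.sum_congr rfl fun j hj => ?_
    simp [utility, Fin.sum_univ_three, h j (Finset.ne_of_mem_erase hj)]
  have s1 := hz.feasible.sum_le 1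
  have s2 := hz.feasible.sum_le 2
  rw [← Finset.add_sum_erase _ _ (Finset.mem_univ i₀)] at s1 s2
  have := hz0 i₀ 2
  nlinarith

/-- If agent `i₀` hides most of her value for the first good, she still gets all of it, and
nearly all of the second good. -/
lemma share_ge_of_misreport {δ : ℝ} (hδ : 0 < δ) (hcard : (Fintype.card ι : ℝ) = N)
    (h₀ : w i₀ = ![δ / 3, 1 / 3, 0]) (h : ∀ i ≠ i₀, w i = ![0, 1 / 3, (N - 1) / 3])
    (hw : IsMarket w) (hz : IsOptimal w z) : z i₀ 0 = 1 ∧ 1 - δ ≤ z i₀ 1 := by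
  classical
  have hu := utility_pos hw hz
  have hz0 := hz.feasible.nonneg
  have hfirst : z i₀ 0 = 1 := by
    rw [← hz.sum_eq_one hw (j := i₀) (k := 0) (by simp [h₀, hδ]), eq_comm]
    refine Finset.sum_eq_single i₀ (fun j _ hj => ?_) (by simp)
    by_contra hne
    have := hz.mul_utility_le hw ((hz0 j 0).lt_of_ne' hne) i₀
    simp only [h j hj, h₀, Matrix.cons_val_zero, zero_mul] at this
    nlinarith [mul_pos hδ (hu j)]
  refine ⟨hfirst, ?_⟩
  by_contra! hlt
  -- somebody else gets a part of the second good
  have s1 := hz.sum_eq_one hw (j := i₀) (k := 1) (by simp [h₀])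
  rw [← Finset.add_sum_erase _ _ (Finset.mem_univ i₀)] at s1
  obtain ⟨j, hj, hzj⟩ : ∃ j ∈ Finset.univ.erase i₀, 0 < z j 1 :=
    Finset.exists_lt_of_sum_lt (f := fun _ => (0 : ℝ)) (by rw [Finset.sum_const_zero]; linarith)
  have hji := Finset.ne_of_mem_erase hj
  have hN1 : 0 < N - 1 := by
    have : 1 < Fintype.card ι := Fintype.one_lt_card_iff.2 ⟨j, i₀, hji⟩
    have : (1 : ℝ) < Fintype.card ι := by exact_mod_cast this
    linarith
  have hju : utility w z j ≤ utility w z i₀ := by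
    have := hz.mul_utility_le hw hzj i₀
    simp only [h j hji, h₀, Matrix.cons_val_one, Matrix.cons_val_zero] at this
    linarith
  have hutil : ∀ i ≠ i₀, utility w z i = 1 / 3 * z i 1 + (N - 1) / 3 * z i 2 := by
    intro i hi
    simp [utility, Fin.sum_univ_three, h i hi]
  -- so her utility, which the others share, does not exceed that of `i₀`
  have hall : ∀ i ∈ Finset.univ.erase i₀, utility w z i ≤ utility w z i₀ := by
    intro i hi
    refine le_trans ?_ hju
    have hi := Finset.ne_of_mem_erase hi
    rcases (hz0 i 1).eq_or_lt with h1 | h1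
    · rcases (hz0 i 2).eq_or_lt with h2 | h2
      · have := hu i
        rw [hutil i hi, ← h1, ← h2] at this
        simp at this
      · have := hz.mul_utility_le hw h2 j
        rw [h i hi, h j hji] at this
        exact le_of_mul_le_mul_left this (show (0 : ℝ) < (N - 1) / 3 by positivity)
    · have := hz.mul_utility_le hw h1 j
      rw [h i hi, h j hji] at this
      exact le_of_mul_le_mul_left this (show (0 : ℝ) < 1 / 3 by norm_num)
  have hcard' : ((Finset.univ.erase i₀).card : ℝ) = N - 1 := by
    rw [Finset.card_erase_of_mem (Finset.mem_univ _), Finset.card_univ,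
      Nat.cast_sub (Fintype.card_pos_iff.2 ⟨i₀⟩), hcard, Nat.cast_one]
  have hle := Finset.sum_le_sum hall
  rw [Finset.sum_const, nsmul_eq_mul, hcard'] at hle
  have hsum : ∑ j ∈ Finset.univ.erase i₀, utility w z j =
      1 / 3 * ∑ j ∈ Finset.univ.erase i₀, z j 1 +
        (N - 1) / 3 * ∑ j ∈ Finset.univ.erase i₀, z j 2 := by
    rw [Finset.mul_sum, Finset.mul_sum, ← Finset.sum_add_distrib]
    exact Finset.sum_congr rfl fun j hj => hutil j (Finset.ne_of_mem_erase hj)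
  have s2 := hz.sum_eq_one hw (j := j) (k := 2) (by simp [h j hji]; linarith)
  rw [← Finset.add_sum_erase _ _ (Finset.mem_univ i₀)] at s2
  have hz2 : z i₀ 2 = 0 := by
    by_contra hne
    have := hz.mul_utility_le hw ((hz0 i₀ 2).lt_of_ne' hne) j
    simp only [h j hji, h₀, Matrix.cons_val] at this
    nlinarith [mul_pos hN1 (hu i₀)]
  have hu₀ : utility w z i₀ = δ / 3 + 1 / 3 * z i₀ 1 := by
    simp [utility, Fin.sum_univ_three, h₀, hfirst]
  rw [hsum, hu₀, show ∑ j ∈ Finset.univ.erase i₀, z j 2 = 1 by linarith,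
    show ∑ j ∈ Finset.univ.erase i₀, z j 1 = 1 - z i₀ 1 by linarith] at hle
  nlinarith

end ThreeGoods

/-! ### Densities on three thirds of the cake -/

/-- The left end points of the three thirds of the cake. -/
noncomputable abbrev thirdLeft (k : Fin 3) : ℝ := (k.val : ℝ) / 3

/-- The right end points of the three thirds of the cake. -/
noncomputable abbrev thirdRight (k : Fin 3) : ℝ := (k.val + 1 : ℝ) / 3

lemma isGrid_thirds : IsGrid thirdLeft thirdRight := by
  have key : ∀ k l : Fin 3, k < l → Disjoint (Ioo ((k.val : ℝ) / 3) ((k.val + 1) / 3))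
      (Ioo ((l.val : ℝ) / 3) ((l.val + 1) / 3)) := by
    intro k l hkl
    rw [disjoint_left]
    intro x hx hx'
    have : (k.val : ℝ) + 1 ≤ l.val := by exact_mod_cast hkl
    linarith [hx.2, hx'.1]
  refine ⟨fun k => by simp only [thirdLeft, thirdRight]; linarith, fun k l hkl => ?_, ?_⟩
  · rcases lt_or_gt_of_ne hkl with h | h
    · exact key k l h
    · exact (key l k h).symm
  · ext x
    simp only [mem_iUnion, Fin.exists_fin_succ, cake, mem_Icc]
    simp [thirdLeft, thirdRight]
    constructor
    · rintro (h | h | h) <;> constructor <;> linarith [h.1, h.2]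
    · rintro ⟨h0, h1⟩
      rcases le_total x (1 / 3) with h | h
      · exact Or.inl ⟨h0, by linarith⟩
      rcases le_total x (2 / 3) with h' | h'
      · exact Or.inr (Or.inl ⟨by linarith, by linarith⟩)
      · exact Or.inr (Or.inr ⟨by linarith, by linarith⟩)

lemma exists_isThreeStep {α β γ : ℝ} (hα : 0 ≤ α) (hβ : 0 ≤ β) (hγ : 0 ≤ γ)
    (hpos : 0 < α + β + γ) : ∃ f : Density, IsThreeStep f α β γ := by
  let F : ℝ → ℝ := fun x => (Icc (0 : ℝ) (1 / 3)).indicator (fun _ => α) x +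
    (Ioc (1 / 3 : ℝ) (2 / 3)).indicator (fun _ => β) x +
    (Ioc (2 / 3 : ℝ) 1).indicator (fun _ => γ) x
  have h1 : ∀ x ∈ Icc (0 : ℝ) (1 / 3), F x = α := by
    intro x hx
    have h2 : x ∉ Ioc (1 / 3 : ℝ) (2 / 3) := fun h => by linarith [h.1, hx.2]
    have h3 : x ∉ Ioc (2 / 3 : ℝ) 1 := fun h => by linarith [h.1, hx.2]
    simp only [F, indicator_of_mem hx, indicator_of_notMem h2, indicator_of_notMem h3, add_zero]
  have h2 : ∀ x ∈ Ioc (1 / 3 : ℝ) (2 / 3), F x = β := by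
    intro x hx
    have h1 : x ∉ Icc (0 : ℝ) (1 / 3) := fun h => by linarith [h.2, hx.1]
    have h3 : x ∉ Ioc (2 / 3 : ℝ) 1 := fun h => by linarith [h.1, hx.2]
    simp only [F, indicator_of_mem hx, indicator_of_notMem h1, indicator_of_notMem h3, add_zero,
      zero_add]
  have h3 : ∀ x ∈ Ioc (2 / 3 : ℝ) 1, F x = γ := by
    intro x hx
    have h1 : x ∉ Icc (0 : ℝ) (1 / 3) := fun h => by linarith [h.2, hx.1]
    have h2 : x ∉ Ioc (1 / 3 : ℝ) (2 / 3) := fun h => by linarith [h.2, hx.1]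
    simp only [F, indicator_of_mem hx, indicator_of_notMem h1, indicator_of_notMem h2, zero_add]
  have hzero : ∀ x, x ∉ cake → F x = 0 := by
    intro x hx
    have h1 : x ∉ Icc (0 : ℝ) (1 / 3) := fun h => hx ⟨h.1, by linarith [h.2]⟩
    have h2 : x ∉ Ioc (1 / 3 : ℝ) (2 / 3) := fun h => hx ⟨by linarith [h.1], by linarith [h.2]⟩
    have h3 : x ∉ Ioc (2 / 3 : ℝ) 1 := fun h => hx ⟨by linarith [h.1], h.2⟩
    simp only [F, indicator_of_notMem h1, indicator_of_notMem h2, indicator_of_notMem h3, add_zero]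
  have hpc : PiecewiseConstant F := by
    refine ⟨3, ![Icc 0 (1 / 3), Ioc (1 / 3) (2 / 3), Ioc (2 / 3) 1], ?_, ?_, ?_, ?_⟩
    · intro t
      fin_cases t
      · exact ordConnected_Icc
      · exact ordConnected_Ioc
      · exact ordConnected_Ioc
    · have d1 : Disjoint (Icc (0 : ℝ) (1 / 3)) (Ioc (1 / 3) (2 / 3)) :=
        disjoint_left.2 fun x hx hx' => by linarith [hx.2, hx'.1]
      have d2 : Disjoint (Icc (0 : ℝ) (1 / 3)) (Ioc (2 / 3) 1) :=
        disjoint_left.2 fun x hx hx' => by linarith [hx.2, hx'.1]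
      have d3 : Disjoint (Ioc (1 / 3 : ℝ) (2 / 3)) (Ioc (2 / 3) 1) :=
        disjoint_left.2 fun x hx hx' => by linarith [hx.2, hx'.1]
      intro s t hst
      fin_cases s <;> fin_cases t
      exacts [absurd rfl hst, d1, d2, d1.symm, absurd rfl hst, d3, d2.symm, d3.symm,
        absurd rfl hst]
    · ext x
      simp only [mem_iUnion, Fin.exists_fin_succ, cake]
      simp
      constructor
      · rintro (h | h | h) <;> constructor <;> linarith [h.1, h.2]
      · rintro ⟨h0, h1⟩
        rcases le_or_gt x (1 / 3) with h | h
        · exact Or.inl ⟨h0, by linarith⟩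
        rcases le_or_gt x (2 / 3) with h' | h'
        · exact Or.inr (Or.inl ⟨by linarith, by linarith⟩)
        · exact Or.inr (Or.inr ⟨by linarith, by linarith⟩)
    · intro t
      fin_cases t
      · exact ⟨α, h1⟩
      · exact ⟨β, h2⟩
      · exact ⟨γ, h3⟩
  have hint : ∫ x in cake, F x = (α + β + γ) / 3 := by
    have hfin : IsFiniteMeasure (volume.restrict cake) := ⟨by simp [cake]⟩
    have hI : ∀ (S : Set ℝ) (c : ℝ), MeasurableSet S →
        Integrable (S.indicator fun _ => c) (volume.restrict cake) := fun S c hS =>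
      (integrable_const c).indicator hS
    have hval : ∀ (S : Set ℝ) (c : ℝ), MeasurableSet S → S ⊆ cake →
        ∫ x in cake, S.indicator (fun _ => c) x = volume.real S * c := fun S c hS hSc => by
      rw [integral_indicator_const _ hS, measureReal_restrict_apply hS, inter_eq_left.2 hSc,
        smul_eq_mul]
    have h12 := (hI (Icc 0 (1 / 3)) α measurableSet_Icc).add
      (hI (Ioc (1 / 3) (2 / 3)) β measurableSet_Ioc)
    refine (integral_add h12 (hI (Ioc (2 / 3) 1) γ measurableSet_Ioc)).trans ?_
    rw [integral_add' (hI _ _ measurableSet_Icc)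
      (hI _ _ measurableSet_Ioc), hval _ _ measurableSet_Icc (Icc_subset_Icc le_rfl (by norm_num)),
      hval _ _ measurableSet_Ioc (Ioc_subset_Icc_self.trans (Icc_subset_Icc (by norm_num)
        (by norm_num))),
      hval _ _ measurableSet_Ioc (Ioc_subset_Icc_self.trans (Icc_subset_Icc (by norm_num) le_rfl)),
      Real.volume_real_Icc_of_le (by norm_num), Real.volume_real_Ioc_of_le (by norm_num),
      Real.volume_real_Ioc_of_le (by norm_num)]
    ring
  refine ⟨⟨F, fun x => ?_, hzero, hpc, by rw [hint]; positivity⟩, h1, h2, h3⟩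
  exact add_nonneg (add_nonneg (indicator_nonneg (fun _ _ => hα) _)
    (indicator_nonneg (fun _ _ => hβ) _)) (indicator_nonneg (fun _ _ => hγ) _)

lemma IsThreeStep.isStepOn {f : Density} {α β γ : ℝ} (h : IsThreeStep f α β γ) :
    IsStepOn thirdLeft thirdRight f ![α, β, γ] := by
  intro k x hx
  fin_cases k
  · simp [thirdLeft, thirdRight] at hx
    exact h.1 x ⟨by linarith [hx.1], by linarith [hx.2]⟩
  · simp [thirdLeft, thirdRight] at hx
    exact h.2.1 x ⟨by linarith [hx.1], by linarith [hx.2]⟩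
  · simp [thirdLeft, thirdRight] at hx
    exact h.2.2 x ⟨by linarith [hx.1], by linarith [hx.2]⟩

lemma cellValue_thirds {n : ℕ} {c : Fin n → Fin 3 → ℝ} {i : Fin n} {α β γ : ℝ}
    (h : c i = ![α, β, γ]) :
    cellValue thirdLeft thirdRight c i =
      ![α / 3, β / 3, γ / 3] := by
  ext k
  rw [cellValue, h, ← sub_div, add_sub_cancel_left]
  fin_cases k <;> simp [div_eq_mul_inv]

/-- In a profile on the three thirds, agent `i₀` nearly doubles her value by a misreport. -/
lemma exists_profitable_misreport {n : ℕ} (i₀ : Fin n) : ∃ f : Fin n → Density,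
    IsThreeStep (f i₀) n (n - 1) 0 ∧ (∀ i, i ≠ i₀ → IsThreeStep (f i) 0 1 (n - 1)) ∧
    ∀ ε : ℝ, 0 < ε → ∃ g : Density, (∃ a b c : ℝ, IsThreeStep g a b c) ∧
      ∀ A A' : Fin n → Set ℝ, IsFreeDisposalMNW f A →
        IsFreeDisposalMNW (Function.update f i₀ g) A' →
        0 < value (f i₀) (A i₀) ∧
        2 - 1 / (n : ℝ) - ε ≤ value (f i₀) (A' i₀) / value (f i₀) (A i₀) := by
  classical
  have hn : 1 ≤ n := Nat.one_le_iff_ne_zero.2 (by rintro rfl; exact i₀.elim0)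
  have hn' : (1 : ℝ) ≤ n := by exact_mod_cast hn
  obtain ⟨f₁, hf₁⟩ := exists_isThreeStep (α := n) (β := n - 1) (γ := 0) (by linarith)
    (by linarith) le_rfl (by linarith)
  obtain ⟨f₂, hf₂⟩ := exists_isThreeStep (α := 0) (β := 1) (γ := n - 1) le_rfl zero_le_one
    (by linarith) (by linarith)
  let f : Fin n → Density := fun i => if i = i₀ then f₁ else f₂
  have hf₀ : f i₀ = f₁ := by simp [f]
  have hfi : ∀ i, i ≠ i₀ → f i = f₂ := fun i hi => by simp [f, hi]
  refine ⟨f, hf₀ ▸ hf₁, fun i hi => hfi i hi ▸ hf₂, fun ε hε => ?_⟩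
  obtain ⟨g, hg⟩ := exists_isThreeStep (α := ε) (β := 1) (γ := 0) hε.le zero_le_one le_rfl
    (by linarith)
  refine ⟨g, ⟨_, _, _, hg⟩, fun A A' hA hA' => ?_⟩
  let c : Fin n → Fin 3 → ℝ := fun i => if i = i₀ then ![n, n - 1, 0] else ![0, 1, n - 1]
  let c' : Fin n → Fin 3 → ℝ := fun i => if i = i₀ then ![ε, 1, 0] else ![0, 1, n - 1]
  have hc : ∀ i, IsStepOn thirdLeft thirdRight (f i) (c i) := by
    intro i
    by_cases hi : i = i₀
    · simp only [f, c, hi, if_true]; exact hf₁.isStepOn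
    · simp only [f, c, hi, if_false]; exact hf₂.isStepOn
  have hc' : ∀ i, IsStepOn thirdLeft thirdRight (Function.update f i₀ g i) (c' i) := by
    intro i
    by_cases hi : i = i₀
    · subst hi
      simp only [c', if_true, Function.update_self]; exact hg.isStepOn
    · simp only [f, c', hi, if_false, Function.update_of_ne hi]
      exact hf₂.isStepOn
  have hw := isMarket_cellValue isGrid_thirds hc
  have hw' := isMarket_cellValue isGrid_thirds hc'
  have hopt := hA.isOptimal hn isGrid_thirds hc
  have hopt' := hA'.isOptimal hn isGrid_thirds hc'
  have hw₀ : cellValue thirdLeft thirdRight c i₀ = ![(n : ℝ) / 3, ((n : ℝ) - 1) / 3, 0] := by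
    rw [cellValue_thirds (α := n) (β := n - 1) (γ := 0) (by simp [c]), zero_div]
  have hwi : ∀ i ≠ i₀, cellValue thirdLeft thirdRight c i = ![0, 1 / 3, ((n : ℝ) - 1) / 3] := by
    intro i hi
    rw [cellValue_thirds (α := 0) (β := 1) (γ := n - 1) (by simp [c, hi]), zero_div]
  have hw₀' : cellValue thirdLeft thirdRight c' i₀ = ![ε / 3, 1 / 3, 0] := by
    rw [cellValue_thirds (α := ε) (β := 1) (γ := 0) (by simp [c']), zero_div]
  have hwi' : ∀ i ≠ i₀, cellValue thirdLeft thirdRight c' i = ![0, 1 / 3, ((n : ℝ) - 1) / 3] := by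
    intro i hi
    rw [cellValue_thirds (α := 0) (β := 1) (γ := n - 1) (by simp [c', hi]), zero_div]
  have hupper := utility_le_of_truthful (by simp) hw₀ hwi hw hopt
  obtain ⟨h0, h1⟩ := share_ge_of_misreport hε (by simp) hw₀' hwi' hw' hopt'
  have hpos := utility_pos hw hopt i₀
  rw [(hc i₀).value_eq_utility isGrid_thirds (hA.1.1 i₀),
    (hc i₀).value_eq_utility isGrid_thirds (hA'.1.1 i₀)]
  refine ⟨hpos, ?_⟩
  have hlow : (2 - 1 / (n : ℝ) - ε) * (n / 3) ≤ 
      utility (cellValue thirdLeft thirdRight c) (share thirdLeft thirdRight A') i₀ := by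
    rw [utility, Fin.sum_univ_three, hw₀, h0]
    have : (2 - 1 / (n : ℝ) - ε) * (n / 3) = (2 * n - 1 - n * ε) / 3 := by
      field_simp
    simp only [Matrix.cons_val]
    nlinarith
  rw [le_div_iff₀ hpos]
  have hnonneg := utility_nonneg hw hopt'.feasible i₀
  rcases le_total 0 (2 - 1 / (n : ℝ) - ε) with h | h
  · exact (mul_le_mul_of_nonneg_left hupper h).trans hlow
  · exact (mul_nonpos_of_nonpos_of_nonneg h hpos.le).trans hnonneg

/-! ### Incentive ratios of mechanisms -/

lemma IsMNWMechanism.isFreeDisposalMNWMechanism {M : Mechanism} (hM : IsMNWMechanism M) :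
    IsFreeDisposalMNWMechanism M := fun n hn f => (hM n hn f).isFreeDisposalMNW hn

lemma IsFreeDisposalMNWMechanism.le_incentiveRatioFor {M : Mechanism}
    (hM : IsFreeDisposalMNWMechanism M) {n : ℕ} (hn : 1 ≤ n) :
    ENNReal.ofReal (2 - 1 / (n : ℝ)) ≤ incentiveRatioFor M n := by
  obtain ⟨f, -, -, hf⟩ := exists_profitable_misreport (⟨0, hn⟩ : Fin n)
  refine ENNReal.le_of_forall_pos_le_add fun ε hε _ => ?_
  obtain ⟨g, -, hg⟩ := hf ε (by exact_mod_cast hε)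
  obtain ⟨hpos, hle⟩ := hg _ _ (hM n hn f) (hM n hn _)
  calc ENNReal.ofReal (2 - 1 / (n : ℝ))
      = ENNReal.ofReal ((2 - 1 / (n : ℝ) - ε) + ε) := by rw [sub_add_cancel]
    _ ≤ ENNReal.ofReal (2 - 1 / (n : ℝ) - ε) + ENNReal.ofReal ε := ENNReal.ofReal_add_le
    _ ≤ incentiveRatioFor M n + ε := by
        rw [ENNReal.ofReal_coe_nnreal]
        gcongr
        refine (ENNReal.ofReal_le_ofReal hle).trans ?_
        rw [ENNReal.ofReal_div_of_pos hpos]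
        exact le_iSup_of_le f (le_iSup_of_le ⟨0, hn⟩ (le_iSup_of_le g le_rfl))

lemma IsFreeDisposalMNWMechanism.two_le_incentiveRatio {M : Mechanism}
    (hM : IsFreeDisposalMNWMechanism M) : 2 ≤ incentiveRatio M := by
  have hlim : Filter.Tendsto (fun n : ℕ => ENNReal.ofReal (2 - 1 / ((n : ℝ) + 1))) Filter.atTop
      (nhds (ENNReal.ofReal (2 - 0))) :=
    ENNReal.tendsto_ofReal (tendsto_const_nhds.sub tendsto_one_div_add_atTop_nhds_zero_nat)
  rw [sub_zero, ENNReal.ofReal_ofNat] at hlim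
  refine le_of_tendsto' hlim fun n => ?_
  have := hM.le_incentiveRatioFor (Nat.le_add_left 1 n)
  rw [Nat.cast_add, Nat.cast_one] at this
  exact this.trans (le_iSup (incentiveRatioFor M) _)

lemma IsMNW.value_misreport_le {n : ℕ} {f : Fin n → Density} {i : Fin n} {g : Density}
    {A A' : Fin n → Set ℝ} (hA : IsMNW f A) (hA' : IsMNW (Function.update f i g) A') :
    value (f i) (A' i) ≤ 2 * value (f i) (A i) := by
  classical
  have hn : 1 ≤ n := Nat.one_le_iff_ne_zero.2 (by rintro rfl; exact i.elim0)
  obtain ⟨m, a, b, d, h, hd⟩ := exists_grid fun o : Option (Fin n) => o.elim g f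
  let c : Fin n → Fin m → ℝ := fun j => d (some j)
  let c' : Fin n → Fin m → ℝ := Function.update c i (d none)
  have hc : ∀ j, IsStepOn a b (f j) (c j) := fun j => hd (some j)
  have hc' : ∀ j, IsStepOn a b (Function.update f i g j) (c' j) := by
    intro j
    by_cases hj : j = i
    · subst hj
      simp only [c', Function.update_self]; exact hd none
    · simp only [c', Function.update_of_ne hj]; exact hc j
  have hw := isMarket_cellValue h hc
  have hopt := (hA.isFreeDisposalMNW hn).isOptimal hn h hc
  rw [(hc i).value_eq_utility h (hA.1.1.1 i), (hc i).value_eq_utility h (hA'.1.1.1 i)]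
  refine misreport_utility_le hw (isMarket_cellValue h hc') hopt
    ((hA'.isFreeDisposalMNW hn).isOptimal hn h hc') (hA.1.sum_share h) (hA'.1.sum_share h) i
    fun j hj => ?_
  ext k
  simp only [cellValue, c', Function.update_of_ne hj]

lemma IsMNWMechanism.incentiveRatio_le_two {M : Mechanism} (hM : IsMNWMechanism M) :
    incentiveRatio M ≤ 2 := by
  refine iSup_le fun n => iSup_le fun f => iSup_le fun i => iSup_le fun g => ?_
  have hn : 1 ≤ n := Nat.one_le_iff_ne_zero.2 (by rintro rfl; exact i.elim0)
  have hle := (hM n hn f).value_misreport_le (hM n hn (Function.update f i g))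
  refine ENNReal.div_le_of_le_mul ?_
  rw [← ENNReal.ofReal_ofNat 2, ← ENNReal.ofReal_mul zero_le_two]
  exact ENNReal.ofReal_le_ofReal hle

lemma exists_isMNWMechanism : ∃ M : Mechanism, IsMNWMechanism M := by
  classical
  refine ⟨fun n f => if hn : 1 ≤ n then (exists_isMNW hn f).choose else fun _ => ∅,
    fun n hn f => ?_⟩
  simp only [dif_pos hn]
  exact (exists_isMNW hn f).choose_spec

end CakeCutting

theorem mainTheorem1 :
    -- MNW mechanisms exist, without and with free disposal
    (∃ M : Mechanism, IsMNWMechanism M) ∧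
    (∃ M : Mechanism, IsFreeDisposalMNWMechanism M) ∧
    -- without free disposal, the incentive ratio is exactly two, whatever the tie-breaking
    (∀ M : Mechanism, IsMNWMechanism M →
      incentiveRatio M = 2 ∧
      ∀ n : ℕ, 1 ≤ n → ENNReal.ofReal (2 - 1 / (n : ℝ)) ≤ incentiveRatioFor M n) ∧
    -- the lower bounds hold with free disposal too
    (∀ M : Mechanism, IsFreeDisposalMNWMechanism M →
      2 ≤ incentiveRatio M ∧
      ∀ n : ℕ, 1 ≤ n → ENNReal.ofReal (2 - 1 / (n : ℝ)) ≤ incentiveRatioFor M n) ∧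
    -- they are witnessed by an explicit profile on three intervals
    (∀ (n : ℕ) (hn : 1 ≤ n), ∃ f : Fin n → Density,
      IsThreeStep (f ⟨0, hn⟩) n (n - 1) 0 ∧
      (∀ i : Fin n, i ≠ ⟨0, hn⟩ → IsThreeStep (f i) 0 1 (n - 1)) ∧
      ∀ ε : ℝ, 0 < ε → ∃ g : Density, (∃ a b c : ℝ, IsThreeStep g a b c) ∧
        ∀ A A' : Fin n → Set ℝ, IsFreeDisposalMNW f A →
          IsFreeDisposalMNW (Function.update f ⟨0, hn⟩ g) A' →
          2 - 1 / (n : ℝ) - ε ≤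
            value (f ⟨0, hn⟩) (A' ⟨0, hn⟩) / value (f ⟨0, hn⟩) (A ⟨0, hn⟩)) := by
  obtain ⟨M₀, hM₀⟩ := exists_isMNWMechanism
  refine ⟨⟨M₀, hM₀⟩, ⟨M₀, hM₀.isFreeDisposalMNWMechanism⟩, fun M hM => ?_, fun M hM =>
    ⟨hM.two_le_incentiveRatio, fun n hn => hM.le_incentiveRatioFor hn⟩, fun n hn => ?_⟩
  · have hM' := hM.isFreeDisposalMNWMechanism
    exact ⟨le_antisymm hM.incentiveRatio_le_two hM'.two_le_incentiveRatio,
      fun n hn => hM'.le_incentiveRatioFor hn⟩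
  · obtain ⟨f, h₁, h₂, h₃⟩ := exists_profitable_misreport (⟨0, hn⟩ : Fin n)
    refine ⟨f, h₁, h₂, fun ε hε => ?_⟩
    obtain ⟨g, hg, h⟩ := h₃ ε hε
    exact ⟨g, hg, fun A A' hA hA' => (h A A' hA hA').2⟩
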